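/- All vector spaces are real. A Banach sequence lattice $Y$ is a linear space of real sequences that contains every canonical sequence $e_k$, with a norm $\|\cdot\|_Y$ that makes it a Banach space, such that $|f|\le|g|$ (coordinatewise) and $g\in Y$ imply $f\in Y$ and $\|f\|_Y\le\|g\|_Y$. For $t\in\mathbb R^n$ put $\|t\|_{\mathbb R^n,Y}=\|(t_1,\dots,t_n,0,0,\dots)\|_Y$. Let $X$ be a Banach lattice. For $x=(x_1,\dots,x_n)\in X^n$ let $\tau_{n,x}:\mathcal H_n\to X$ be Krivine's functional calculus, that is, the unique linear map on the space $\mathcal H_n$ of continuous functions $h:\mathbb R^n\to\mathbb R$ with $h(\lambda t)=\lambda h(t)$ for $\lambda\ge 0$ that sends the $j$-th coordinate projection to $x_j$ and satisfies $\tau_{n,x}(h_1\vee h_2)=\tau_{n,x}(h_1)\vee\tau_{n,x}(h_2)$, and put $\|x\|_{X^n,Y,\tau}=\big\|\tau_{n,x}(\|\cdot\|_{\mathbb R^n,Y})\big\|_X$. For a Banach space $E$ and $w\in E^n$ put $\|w\|_{E^n,Y}=\|(\|w_1\|_E,\dots,\|w_n\|_E)\|_{\mathbb R^n,Y}$. A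 linear operator $T:E\to X$ is $Y$-convex if there is $C>0$ with $\|(Tw_1,\dots,Tw_n)\|_{X^n,Y,\tau}\le C\,\|(w_1,\dots,w_n)\|_{E^n,Y}$ for all $n$ and $w_1,\dots,w_n\in E$. A linear operator $S:X\to E$ is $Y$-concave if there is $C>0$ with $\|(Sx_1,\dots,Sx_n)\|_{E^n,Y}\le C\,\|(x_1,\dots,x_n)\|_{X^n,Y,\tau}$ for all $n$ and $x_1,\dots,x_n\in X$. The $Y$-convexity constant $M^Y(T)$ and the $Y$-concavity constant $M_Y(S)$ are the smallest constants $C\ge 0$ in these inequalities. **Theorem.** Let $Y$ be a Banach sequence lattice, $E$ a Banach space and $X$ a Banach lattice. (i) The set $\mathcal K^Y(E,X)$ of $Y$-convex operators $T:E\to X$ is a vector space, the smallest constant $M^Y(T)$ exists for each such $T$, $M^Y$ is a norm on $\mathcal K^Y(E,X)$, and $(\mathcal K^Y(E,X),M^Y)$ is a Banach space. Every $T\in\mathcal K^Y(E,X)$ is bounded, with $\|T\|\le M^Y(T)$. (ii) The set $\mathcal K_Y(X,E)$ of $Y$-concave operators $S:X\to E$ is a vector space, the smallest constant $M_Y(S)$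 exists for each such $S$, $M_Y$ is a norm on $\mathcal K_Y(X,E)$, and $(\mathcal K_Y(X,E),M_Y)$ is a Banach space. Every $S\in\mathcal K_Y(X,E)$ is bounded, with $\|S\|\le M_Y(S)$. -/

import Mathlib

/-- `N` is a norm on the real vector space `V` and `(V, N)` is a Banach space. -/
def IsBanachNorm {V : Type*} [AddCommGroup V] [Module ℝ V] (N : V → ℝ) : Prop :=
  letI : Norm V := ⟨N⟩
  ∃ core : NormedSpace.Core ℝ V,
    letI : NormedAddCommGroup V := NormedAddCommGroup.ofCore core
    CompleteSpace V

/-- A Banach sequence lattice: an ideal of the Riesz space of all real sequences which contains the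
canonical sequences and is a Banach space for an order-preserving norm. -/
structure BanachSequenceLattice where
  /-- the underlying space of sequences -/
  carrier : Submodule ℝ (ℕ → ℝ)
  /-- the norm -/
  norm : carrier → ℝ
  isBanachNorm : IsBanachNorm norm
  mem_of_abs_le : ∀ f g : ℕ → ℝ, g ∈ carrier → |f| ≤ |g| → f ∈ carrier
  norm_mono : ∀ f g : carrier, |(f : ℕ → ℝ)| ≤ |(g : ℕ → ℝ)| → norm f ≤ norm g
  single_mem : ∀ k : ℕ, (Pi.single k 1 : ℕ → ℝ) ∈ carrier

/-- The sequence `(t₁, …, tₙ, 0, 0, …)`, as a linear function of `(t₁, …, tₙ)`. -/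
def extendByZero (n : ℕ) : (Fin n → ℝ) →ₗ[ℝ] (ℕ → ℝ) where
  toFun t k := if h : k < n then t ⟨k, h⟩ else 0
  map_add' s t := by ext k; by_cases h : k < n <;> simp [h]
  map_smul' c t := by ext k; by_cases h : k < n <;> simp [h]

theorem extendByZero_eq_sum (n : ℕ) (t : Fin n → ℝ) :
    extendByZero n t = ∑ j : Fin n, t j • (Pi.single (j : ℕ) 1 : ℕ → ℝ) := by
  ext k
  rw [Finset.sum_apply]
  by_cases h : k < n
  · rw [Finset.sum_eq_single (⟨k, h⟩ : Fin n)]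
    · simp [extendByZero, h]
    · intro b _ hb
      have : (b : ℕ) ≠ k := fun e => hb (Fin.ext e)
      simp [this.symm]
    · simp
  · rw [Finset.sum_eq_zero]
    · simp [extendByZero, h]
    · intro b _
      have : k ≠ (b : ℕ) := fun e => h (e ▸ b.isLt)
      simp [this]

namespace BanachSequenceLattice

theorem extendByZero_mem (Y : BanachSequenceLattice) {n : ℕ} (t : Fin n → ℝ) :
    extendByZero n t ∈ Y.carrier := by
  rw [extendByZero_eq_sum]
  exact Submodule.sum_mem _ fun j _ => Submodule.smul_mem _ _ (Y.single_mem j)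

/-- The norm `‖(t₁, …, tₙ)‖_{ℝⁿ, Y}`. -/
def finNorm (Y : BanachSequenceLattice) (n : ℕ) (t : Fin n → ℝ) : ℝ :=
  Y.norm ⟨extendByZero n t, Y.extendByZero_mem t⟩

theorem finNorm_smul (Y : BanachSequenceLattice) (n : ℕ) (c : ℝ) (t : Fin n → ℝ) :
    Y.finNorm n (c • t) = |c| * Y.finNorm n t := by
  let _ : Norm Y.carrier := ⟨Y.norm⟩
  obtain ⟨core, _⟩ := Y.isBanachNorm
  have h := core.norm_smul c ⟨extendByZero n t, Y.extendByZero_mem t⟩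
  simp only [finNorm, map_smul]
  exact h

theorem finNorm_add_le (Y : BanachSequenceLattice) (n : ℕ) (s t : Fin n → ℝ) :
    Y.finNorm n (s + t) ≤ Y.finNorm n s + Y.finNorm n t := by
  let _ : Norm Y.carrier := ⟨Y.norm⟩
  obtain ⟨core, _⟩ := Y.isBanachNorm
  have h := core.norm_triangle ⟨extendByZero n s, Y.extendByZero_mem s⟩
    ⟨extendByZero n t, Y.extendByZero_mem t⟩
  simp only [finNorm, map_add]
  exact h

theorem continuous_finNorm (Y : BanachSequenceLattice) (n : ℕ) : Continuous (Y.finNorm n) := by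
  have hconv : ConvexOn ℝ Set.univ (Y.finNorm n) := by
    refine ⟨convex_univ, fun x _ y _ a b ha hb _ => ?_⟩
    have h := Y.finNorm_add_le n (a • x) (b • y)
    rw [finNorm_smul, finNorm_smul, abs_of_nonneg ha, abs_of_nonneg hb] at h
    simpa using h
  exact continuousOn_univ.mp (hconv.continuousOn isOpen_univ)

end BanachSequenceLattice

/-- The space `𝓗ₙ` of continuous functions `h : ℝⁿ → ℝ` that are homogeneous of degree 1, that is,
`h (c t) = c h(t)` for all `c ≥ 0`. -/
def HomogFun (n : ℕ) : Submodule ℝ C(Fin n → ℝ, ℝ) where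
  carrier := {h | ∀ c : ℝ, 0 ≤ c → ∀ t : Fin n → ℝ, h (c • t) = c * h t}
  add_mem' := by
    intro f g hf hg c hc t
    simp only [ContinuousMap.add_apply, hf c hc t, hg c hc t]
    ring
  zero_mem' := by
    intro c hc t
    simp
  smul_mem' := by
    intro a f hf c hc t
    simp only [ContinuousMap.smul_apply, hf c hc t, smul_eq_mul]
    ring

namespace HomogFun

/-- The pointwise supremum on `𝓗ₙ`. -/
instance (n : ℕ) : Max (HomogFun n) where
  max f g := ⟨f.1 ⊔ g.1, by
    intro c hc t
    simp only [ContinuousMap.sup_apply, f.2 c hc t, g.2 c hc t]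
    exact (mul_max_of_nonneg _ _ hc).symm⟩

/-- The coordinate projection `(t₁, …, tₙ) ↦ tⱼ`. -/
def proj {n : ℕ} (j : Fin n) : HomogFun n :=
  ⟨⟨fun t => t j, continuous_apply j⟩, fun _ _ _ => rfl⟩

/-- The norm `‖·‖_{ℝⁿ, Y}` as an element of `𝓗ₙ`. -/
def ofNorm (Y : BanachSequenceLattice) (n : ℕ) : HomogFun n :=
  ⟨⟨Y.finNorm n, Y.continuous_finNorm n⟩, fun c hc t => by
    change Y.finNorm n (c • t) = c * Y.finNorm n t
    rw [Y.finNorm_smul, abs_of_nonneg hc]⟩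

end HomogFun

section Krivine

variable {X : Type*} [NormedAddCommGroup X] [NormedSpace ℝ X] [Lattice X]

/-- `τ : 𝓗ₙ → X` is Krivine's functional calculus at `x ∈ Xⁿ`: it is linear, preserves suprema
and maps the `j`-th projection to `xⱼ`. -/
structure IsKrivineCalculus {n : ℕ} (x : Fin n → X) (τ : HomogFun n →ₗ[ℝ] X) : Prop where
  map_proj : ∀ j, τ (HomogFun.proj j) = x j
  map_sup : ∀ f g, τ (f ⊔ g) = τ f ⊔ τ g

open Classical in
/-- Krivine's functional calculus `τ_{n,x}`. In a Banach lattice the map singled out by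
`IsKrivineCalculus` exists and is unique, so that the value `0` below never occurs. -/
noncomputable def krivine {n : ℕ} (x : Fin n → X) : HomogFun n →ₗ[ℝ] X :=
  if h : ∃ τ : HomogFun n →ₗ[ℝ] X, IsKrivineCalculus x τ then h.choose else 0

/-- The norm `‖(x₁, …, xₙ)‖_{Xⁿ, Y, τ} = ‖ ‖(x₁, …, xₙ)‖_Y ‖_X`. -/
noncomputable def latticeNorm (Y : BanachSequenceLattice) {n : ℕ} (x : Fin n → X) : ℝ :=
  ‖krivine x (HomogFun.ofNorm Y n)‖

variable {E : Type*} [NormedAddCommGroup E] [NormedSpace ℝ E]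

/-- The norm `‖(w₁, …, wₙ)‖_{Eⁿ, Y} = ‖(‖w₁‖, …, ‖wₙ‖)‖_Y`. -/
def tupleNorm (Y : BanachSequenceLattice) {n : ℕ} (w : Fin n → E) : ℝ :=
  Y.finNorm n fun j => ‖w j‖

/-- `C` is admissible in the inequality that defines `Y`-convexity of `T`. -/
def YConvexBound (Y : BanachSequenceLattice) (T : E →ₗ[ℝ] X) (C : ℝ) : Prop :=
  ∀ (n : ℕ) (w : Fin n → E), latticeNorm Y (fun j => T (w j)) ≤ C * tupleNorm Y w

/-- The linear operator `T : E → X` is `Y`-convex. -/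
def IsYConvex (Y : BanachSequenceLattice) (T : E →ₗ[ℝ] X) : Prop :=
  ∃ C : ℝ, 0 < C ∧ YConvexBound Y T C

/-- The `Y`-convexity constant `M^Y(T)`. -/
noncomputable def yConvexityConst (Y : BanachSequenceLattice) (T : E →ₗ[ℝ] X) : ℝ :=
  sInf {C : ℝ | 0 ≤ C ∧ YConvexBound Y T C}

/-- `C` is admissible in the inequality that defines `Y`-concavity of `S`. -/
def YConcaveBound (Y : BanachSequenceLattice) (S : X →ₗ[ℝ] E) (C : ℝ) : Prop :=
  ∀ (n : ℕ) (x : Fin n → X), tupleNorm Y (fun j => S (x j)) ≤ C * latticeNorm Y x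

/-- The linear operator `S : X → E` is `Y`-concave. -/
def IsYConcave (Y : BanachSequenceLattice) (S : X →ₗ[ℝ] E) : Prop :=
  ∃ C : ℝ, 0 < C ∧ YConcaveBound Y S C

/-- The `Y`-concavity constant `M_Y(S)`. -/
noncomputable def yConcavityConst (Y : BanachSequenceLattice) (S : X →ₗ[ℝ] E) : ℝ :=
  sInf {C : ℝ | 0 ≤ C ∧ YConcaveBound Y S C}

end Krivine

/-! Both halves are one statement. Let `p n` be continuous seminorms on `Bⁿ` and `q n` nonnegative
functions on `Aⁿ`, both equal to the same multiple `c > 0` of the norm when `n = 1`. The operators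
`T : A → B` with `p(Tw) ≤ C q(w)` on all tuples form a Banach space under the least `C`: tuples of
length one give `‖T‖ ≤ C`, so a Cauchy sequence converges pointwise, and each inequality, involving
finitely many vectors, survives the limit. Convexity and concavity exchange the roles of
`latticeNorm` and `tupleNorm`, with `c = ‖e₁‖_Y`.

The substance is that `latticeNorm` is a continuous seminorm, which requires Krivine's calculus to
exist and be unique. Restrict homogeneous functions to the `ℓ¹`-sphere `K`, and let `G ⊆ C(K) × X`
be the vector sublattice generated by the pairs (coordinate, `xⱼ`). By `linearGraph_le_of_fst_le`, a
Hahn-Banach argument, inequalities between finite suprema of linear forms on `K` pass to `X`. Hence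
`‖z‖ ≤ ‖∑ |xⱼ|‖ ‖f‖` on `G`, and by Stone-Weierstrass the closure of `G` is the graph of a map on
all of `C(K)`. Density also gives uniqueness, hence compatibility with substitution, which turns
pointwise inequalities for `‖·‖_Y` into inequalities for `latticeNorm`. -/

/-! ### Vector sublattice generated by a subspace -/

section SupClosure

variable {W : Type*} [AddCommGroup W] [Lattice W] [IsOrderedAddMonoid W] [Module ℝ W]
  [PosSMulMono ℝ W]

omit [IsOrderedAddMonoid W] in
theorem smul_sup_of_nonneg {c : ℝ} (hc : 0 ≤ c) (a b : W) : c • (a ⊔ b) = c • a ⊔ c • b := by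
  rcases hc.eq_or_lt with rfl | hc'
  · simp
  · apply le_antisymm
    · rw [← le_inv_smul_iff_of_pos hc']
      exact sup_le ((le_inv_smul_iff_of_pos hc').2 le_sup_left)
        ((le_inv_smul_iff_of_pos hc').2 le_sup_right)
    · exact sup_le (smul_le_smul_of_nonneg_left le_sup_left hc)
        (smul_le_smul_of_nonneg_left le_sup_right hc)

-- Translations distribute over suprema, so `⋁ aᵢ + ⋁ bⱼ = ⋁ (aᵢ + bⱼ)`; one induction for each
-- summand.
omit [PosSMulMono ℝ W] in
theorem add_mem_supClosure (L : Submodule ℝ W) {a b : W} (ha : a ∈ supClosure (L : Set W))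
    (hb : b ∈ supClosure (L : Set W)) : a + b ∈ supClosure (L : Set W) := by
  have h₁ : ∀ a ∈ L, ∀ b ∈ supClosure (L : Set W), a + b ∈ supClosure (L : Set W) := by
    intro a ha
    refine supClosure_min (t := {b | a + b ∈ supClosure (L : Set W)})
      (fun b hb => subset_supClosure (L.add_mem ha hb)) fun b hb c hc => ?_
    simp only [Set.mem_ofPred_eq, add_sup] at *
    exact supClosed_supClosure hb hc
  refine supClosure_min (t := {a | a + b ∈ supClosure (L : Set W)})
    (fun a ha => h₁ a ha b hb) (fun a ha c hc => ?_) ha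
  simp only [Set.mem_ofPred_eq, sup_add] at *
  exact supClosed_supClosure ha hc

omit [IsOrderedAddMonoid W] in
theorem smul_mem_supClosure (L : Submodule ℝ W) {c : ℝ} (hc : 0 ≤ c) {a : W}
    (ha : a ∈ supClosure (L : Set W)) : c • a ∈ supClosure (L : Set W) := by
  refine supClosure_min (t := {a | c • a ∈ supClosure (L : Set W)})
    (fun a ha => subset_supClosure (L.smul_mem c ha)) (fun a ha b hb => ?_) ha
  simp only [Set.mem_ofPred_eq, smul_sup_of_nonneg hc] at *
  exact supClosed_supClosure ha hb

omit [PosSMulMono ℝ W] in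
theorem sum_mem_supClosure (L : Submodule ℝ W) {ι : Type*} (s : Finset ι) {f : ι → W}
    (hf : ∀ i ∈ s, f i ∈ supClosure (L : Set W)) : ∑ i ∈ s, f i ∈ supClosure (L : Set W) :=
  Finset.sum_induction f (· ∈ supClosure (L : Set W)) (fun _ _ => add_mem_supClosure L)
    (subset_supClosure L.zero_mem) hf

/-- The vector sublattice generated by a subspace of a Riesz space: the differences of finite suprema
of elements of the subspace. -/
def supDiff (L : Submodule ℝ W) : Submodule ℝ W where
  carrier := {w | ∃ a ∈ supClosure (L : Set W), ∃ b ∈ supClosure (L : Set W), w = a - b}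
  zero_mem' := ⟨0, subset_supClosure L.zero_mem, 0, subset_supClosure L.zero_mem, by simp⟩
  add_mem' := by
    rintro _ _ ⟨a, ha, b, hb, rfl⟩ ⟨c, hc, d, hd, rfl⟩
    exact ⟨a + c, add_mem_supClosure L ha hc, b + d, add_mem_supClosure L hb hd, by abel⟩
  smul_mem' := by
    rintro r _ ⟨a, ha, b, hb, rfl⟩
    rcases le_total 0 r with hr | hr
    · exact ⟨r • a, smul_mem_supClosure L hr ha, r • b, smul_mem_supClosure L hr hb, smul_sub _ _ _⟩
    · have hr' : 0 ≤ -r := neg_nonneg.2 hr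
      exact ⟨(-r) • b, smul_mem_supClosure L hr' hb, (-r) • a, smul_mem_supClosure L hr' ha, by
        module⟩

theorem mem_supDiff_of_mem (L : Submodule ℝ W) {a : W} (ha : a ∈ L) : a ∈ supDiff L :=
  ⟨a, subset_supClosure ha, 0, subset_supClosure L.zero_mem, by simp⟩

/-- Common denominators: `(a - b) ⊔ (c - d) = ((a + d) ⊔ (c + b)) - (b + d)`. -/
theorem supClosed_supDiff (L : Submodule ℝ W) : SupClosed (supDiff L : Set W) := by
  rintro _ ⟨a, ha, b, hb, rfl⟩ _ ⟨c, hc, d, hd, rfl⟩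
  refine ⟨(a + d) ⊔ (c + b), supClosed_supClosure (add_mem_supClosure L ha hd)
    (add_mem_supClosure L hc hb), b + d, add_mem_supClosure L hb hd, ?_⟩
  rw [sub_eq_add_neg _ (b + d), sup_add]
  congr 1 <;> abel

end SupClosure

/-! ### Density of sublattices of continuous functions on the sphere -/

section Sphere

/-- The unit sphere of `ℝⁿ` for the `ℓ¹`-norm. -/
def l1Sphere (n : ℕ) : Set (Fin n → ℝ) := {t | ∑ j, |t j| = 1}

instance (n : ℕ) : CompactSpace (l1Sphere n) := by
  rw [← isCompact_iff_compactSpace]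
  refine Metric.isCompact_of_isClosed_isBounded ?_ ?_
  · exact isClosed_eq (by fun_prop) continuous_const
  · refine (Metric.isBounded_closedBall (x := (0 : Fin n → ℝ)) (r := 1)).subset fun t ht => ?_
    rw [mem_closedBall_zero_iff, pi_norm_le_iff_of_nonneg zero_le_one]
    intro j
    have ht' : ∑ j, |t j| = 1 := ht
    rw [← ht', Real.norm_eq_abs]
    exact Finset.single_le_sum (f := fun j => |t j|) (fun _ _ => abs_nonneg _) (Finset.mem_univ j)

/-- The coordinates as functions on the `ℓ¹`-sphere. -/
def sphereCoord {n : ℕ} (j : Fin n) : C(l1Sphere n, ℝ) :=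
  ⟨fun t => t.1 j, (continuous_apply j).comp continuous_subtype_val⟩

instance ContinuousMap.hasSolidNorm_real {K : Type*} [TopologicalSpace K] [CompactSpace K] :
    HasSolidNorm C(K, ℝ) where
  solid f g h := by
    rw [ContinuousMap.norm_le _ (norm_nonneg _)]
    intro t
    have h' : |f t| ≤ |g t| := h t
    exact h'.trans (g.norm_coe_le_norm t)

/-- Stone-Weierstrass for vector sublattices of `C(K)` which contain the constants and separate the
points of `K`. -/
theorem dense_of_supClosed {K : Type*} [TopologicalSpace K] [CompactSpace K]
    (L : Submodule ℝ C(K, ℝ)) (hsup : SupClosed (L : Set C(K, ℝ))) (h1 : (1 : C(K, ℝ)) ∈ L)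
    (hsep : ∀ s t : K, s ≠ t → ∃ f ∈ L, f s ≠ f t) : Dense (L : Set C(K, ℝ)) := by
  rw [dense_iff_closure_eq]
  refine ContinuousMap.sublattice_closure_eq_top _ ⟨1, h1⟩ (fun f hf g hg => ?_)
    (fun f hf g hg => hsup hf hg) fun v s t => ?_
  · have := L.neg_mem (hsup (L.neg_mem hf) (L.neg_mem hg))
    rwa [neg_sup, neg_neg, neg_neg] at this
  · by_cases hst : s = t
    · subst hst
      exact ⟨v s • 1, L.smul_mem _ h1, by simp, by simp⟩
    · obtain ⟨f, hf, hne⟩ := hsep s t hst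
      have hne' : f s - f t ≠ 0 := sub_ne_zero.2 hne
      refine ⟨((v s - v t) / (f s - f t)) • (f - f t • 1) + v t • 1,
        L.add_mem (L.smul_mem _ (L.sub_mem hf (L.smul_mem _ h1))) (L.smul_mem _ h1), ?_, ?_⟩
      · simp [hne']
      · simp

theorem sum_abs_sphereCoord (n : ℕ) :
    ∑ j : Fin n, |(sphereCoord j : C(l1Sphere n, ℝ))| = 1 := by
  ext t
  rw [ContinuousMap.sum_apply]
  exact t.2

/-- The `ℓ¹`-sphere is chosen so that `1 = ∑ |tⱼ|` is itself a lattice expression in the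
coordinates. -/
theorem dense_of_sphereCoord_mem {n : ℕ} (L : Submodule ℝ C(l1Sphere n, ℝ))
    (hsup : SupClosed (L : Set C(l1Sphere n, ℝ))) (hL : ∀ j, sphereCoord j ∈ L) :
    Dense (L : Set C(l1Sphere n, ℝ)) := by
  refine dense_of_supClosed L hsup ?_ fun s t hst => ?_
  · rw [← sum_abs_sphereCoord]
    exact L.sum_mem fun j _ => hsup (hL j) (L.neg_mem (hL j))
  · obtain ⟨j, hj⟩ := Function.ne_iff.1 (Subtype.coe_injective.ne hst)
    exact ⟨sphereCoord j, hL j, hj⟩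

end Sphere

/-! ### Existence of Krivine's calculus -/

section Existence

variable {X : Type*} [NormedAddCommGroup X] [NormedSpace ℝ X]

/-- The linear forms on `ℝⁿ`, as functions on the sphere, together with their values at `x`. -/
def linearGraph {n : ℕ} (x : Fin n → X) : (Fin n → ℝ) →ₗ[ℝ] C(l1Sphere n, ℝ) × X :=
  Fintype.linearCombination ℝ fun j => (sphereCoord j, x j)

theorem linearGraph_single {n : ℕ} (x : Fin n → X) (j : Fin n) :
    linearGraph x (Pi.single j 1) = (sphereCoord j, x j) := by
  simp [linearGraph]

theorem linearGraph_fst_apply {n : ℕ} (x : Fin n → X) (a : Fin n → ℝ) (t : l1Sphere n) :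
    (linearGraph x a).1 t = ∑ j, a j * t.1 j := by
  simp [linearGraph, Fintype.linearCombination_apply, Prod.fst_sum, ContinuousMap.sum_apply,
    sphereCoord]

variable [Lattice X] [IsOrderedAddMonoid X] [IsOrderedModule ℝ X] [HasSolidNorm X]

/-- The coefficient vectors `b` with `linearGraph x b ≤ q` form a closed convex set. A vector `a`
outside it is strictly separated from it by a functional, which after scaling is evaluation at a
point of the sphere; there `q.1` equals some form in the set, so `a` would exceed `q.1`. -/
theorem linearGraph_le_of_fst_le {n : ℕ} (x : Fin n → X) (a : Fin n → ℝ)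
    {q : C(l1Sphere n, ℝ) × X} (hq : q ∈ supClosure (LinearMap.range (linearGraph x) : Set _))
    (h : (linearGraph x a).1 ≤ q.1) : linearGraph x a ≤ q := by
  have hatt : ∀ t : l1Sphere n, ∃ b, linearGraph x b ≤ q ∧ q.1 t = (linearGraph x b).1 t := by
    intro t
    refine supClosure_min
      (t := {q | ∃ b, linearGraph x b ≤ q ∧ q.1 t = (linearGraph x b).1 t}) ?_ ?_ hq
    · rintro _ ⟨b, rfl⟩
      exact ⟨b, le_rfl, rfl⟩
    · rintro p ⟨b, hb, hbt⟩ r ⟨c, hc, hct⟩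
      rcases le_total (r.1 t) (p.1 t) with hrp | hrp
      · exact ⟨b, hb.trans le_sup_left, (sup_eq_left.2 hrp).trans hbt⟩
      · exact ⟨c, hc.trans le_sup_right, (sup_eq_right.2 hrp).trans hct⟩
  have hconv : Convex ℝ {b | linearGraph x b ≤ q} := by
    intro b hb c hc r s hr hs hrs
    calc linearGraph x (r • b + s • c) = r • linearGraph x b + s • linearGraph x c := by simp
      _ ≤ r • q + s • q :=
        add_le_add (smul_le_smul_of_nonneg_left hb hr) (smul_le_smul_of_nonneg_left hc hs)
      _ = q := by rw [← add_smul, hrs, one_smul]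
  have hclosed : IsClosed {b | linearGraph x b ≤ q} := by
    have hcont := (linearGraph x).continuous_of_finiteDimensional
    exact (isClosed_le hcont.fst continuous_const).inter (isClosed_le hcont.snd continuous_const)
  by_contra ha
  obtain ⟨f, u, hlt, hu⟩ := geometric_hahn_banach_closed_point hconv hclosed
    (x := a) ha
  set v : Fin n → ℝ := fun j => f (Pi.single j 1) with hv
  have hf : ∀ b, f b = ∑ j, b j * v j := by
    intro b
    conv_lhs => rw [pi_eq_sum_univ' b]
    simp [hv, map_sum]
  -- The set is nonempty, so a strictly separating functional cannot vanish.
  have hN : 0 < ∑ j, |v j| := by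
    refine (Finset.sum_nonneg fun _ _ => abs_nonneg _).lt_of_ne' fun h0 => ?_
    have hv0 : ∀ j, v j = 0 := fun j => by
      simpa using (Finset.sum_eq_zero_iff_of_nonneg fun _ _ => abs_nonneg _).1 h0 j
        (Finset.mem_univ j)
    have hf0 : ∀ b, f b = 0 := fun b => by simp [hf, hv0]
    obtain ⟨b, hb⟩ : ∃ b, linearGraph x b ≤ q :=
      supClosure_min (t := {q | ∃ b, linearGraph x b ≤ q})
        (by rintro _ ⟨b, rfl⟩; exact ⟨b, le_rfl⟩)
        (fun p ⟨b, hb⟩ r _ => ⟨b, hb.trans le_sup_left⟩) hq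
    linarith [hlt b hb, hf0 a, hf0 b]
  set N := ∑ j, |v j|
  let t : l1Sphere n := ⟨N⁻¹ • v, by
    change ∑ j, |N⁻¹ * v j| = 1
    simp_rw [abs_mul, ← Finset.mul_sum, abs_of_pos (inv_pos.2 hN)]
    exact inv_mul_cancel₀ hN.ne'⟩
  have ht : ∀ b, (linearGraph x b).1 t = N⁻¹ * f b := by
    intro b
    rw [linearGraph_fst_apply, hf, Finset.mul_sum]
    exact Finset.sum_congr rfl fun j _ => mul_left_comm _ _ _
  obtain ⟨b, hb, hbt⟩ := hatt t
  have hab : (linearGraph x a).1 t ≤ q.1 t := h t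
  rw [hbt, ht, ht] at hab
  have := le_of_mul_le_mul_left hab (inv_pos.2 hN)
  linarith [hlt b hb]

theorem le_of_fst_le_of_mem_supClosure {n : ℕ} (x : Fin n → X) {p q : C(l1Sphere n, ℝ) × X}
    (hp : p ∈ supClosure (LinearMap.range (linearGraph x) : Set _))
    (hq : q ∈ supClosure (LinearMap.range (linearGraph x) : Set _))
    (h : p.1 ≤ q.1) : p ≤ q := by
  refine supClosure_min (t := {p | p.1 ≤ q.1 → p ≤ q}) ?_ ?_ hp h
  · rintro _ ⟨a, rfl⟩
    exact linearGraph_le_of_fst_le x a hq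
  · intro p hp r hr hpr
    exact sup_le (hp (le_sup_left.trans hpr)) (hr (le_sup_right.trans hpr))

/-- The vector sublattice of `C(K) × X` generated by the pairs of a coordinate and its value. -/
def krivineGraph {n : ℕ} (x : Fin n → X) : Submodule ℝ (C(l1Sphere n, ℝ) × X) :=
  supDiff (LinearMap.range (linearGraph x))

omit [HasSolidNorm X] in
theorem coord_mem_krivineGraph {n : ℕ} (x : Fin n → X) (j : Fin n) :
    (sphereCoord j, x j) ∈ krivineGraph x :=
  mem_supDiff_of_mem _ ⟨_, linearGraph_single x j⟩

/-- The constant `1` is paired with `∑ |xⱼ|`, so `p.1 ≤ q.1 + c` on the sphere transfers to `p.2 ≤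
q.2 + c ∑ |xⱼ|`. -/
theorem snd_le_of_mem_krivineGraph {n : ℕ} (x : Fin n → X) {w : C(l1Sphere n, ℝ) × X}
    (hw : w ∈ krivineGraph x) : w.2 ≤ ‖w.1‖ • ∑ j, |x j| := by
  obtain ⟨p, hp, q, hq, rfl⟩ := hw
  set c := ‖(p - q).1‖
  have hu : ((1 : C(l1Sphere n, ℝ)), ∑ j, |x j|) ∈
      supClosure (LinearMap.range (linearGraph x) : Set _) := by
    have h : ((1 : C(l1Sphere n, ℝ)), ∑ j, |x j|) =
        ∑ j, ((sphereCoord j, x j) ⊔ -(sphereCoord j, x j)) := by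
      ext1
      · rw [Prod.fst_sum]
        exact (sum_abs_sphereCoord n).symm
      · rw [Prod.snd_sum]
        rfl
    rw [h]
    refine sum_mem_supClosure _ _ fun j _ => ?_
    have hj : (sphereCoord j, x j) ∈ LinearMap.range (linearGraph x) :=
      ⟨_, linearGraph_single x j⟩
    exact supClosed_supClosure (subset_supClosure hj) (subset_supClosure (neg_mem hj))
  have hle := le_of_fst_le_of_mem_supClosure x hp
    (add_mem_supClosure _ hq (smul_mem_supClosure _ (norm_nonneg (p - q).1) hu)) (fun t => by
      have ht := (le_abs_self _).trans ((p - q).1.norm_coe_le_norm t)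
      change p.1 t ≤ q.1 t + c * 1
      change p.1 t - q.1 t ≤ c at ht
      linarith)
  exact sub_le_iff_le_add'.2 hle.2

theorem norm_snd_le_of_mem_krivineGraph {n : ℕ} (x : Fin n → X) {w : C(l1Sphere n, ℝ) × X}
    (hw : w ∈ krivineGraph x) : ‖w.2‖ ≤ ‖∑ j, |x j|‖ * ‖w.1‖ := by
  have h1 := snd_le_of_mem_krivineGraph x hw
  have h2 := snd_le_of_mem_krivineGraph x (neg_mem hw)
  simp only [Prod.fst_neg, norm_neg, Prod.snd_neg] at h2
  calc ‖w.2‖ ≤ ‖‖w.1‖ • ∑ j, |x j|‖ :=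
        norm_le_norm_of_abs_le_abs ((abs_le'.2 ⟨h1, h2⟩).trans (le_abs_self _))
    _ = _ := by rw [norm_smul, norm_norm, mul_comm]

theorem norm_snd_le_of_mem_topologicalClosure {n : ℕ} (x : Fin n → X)
    {w : C(l1Sphere n, ℝ) × X} (hw : w ∈ (krivineGraph x).topologicalClosure) :
    ‖w.2‖ ≤ ‖∑ j, |x j|‖ * ‖w.1‖ := by
  have hcl : IsClosed {w : C(l1Sphere n, ℝ) × X | ‖w.2‖ ≤ ‖∑ j, |x j|‖ * ‖w.1‖} :=
    isClosed_le (by fun_prop) (by fun_prop)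
  exact closure_minimal (fun w hw => norm_snd_le_of_mem_krivineGraph x hw) hcl hw

theorem supClosed_topologicalClosure_krivineGraph {n : ℕ} (x : Fin n → X) :
    SupClosed ((krivineGraph x).topologicalClosure : Set (C(l1Sphere n, ℝ) × X)) := by
  intro a ha b hb
  have hcont : Continuous (Function.uncurry
      fun a b : C(l1Sphere n, ℝ) × X => (a.1 ⊔ b.1, a.2 ⊔ b.2)) := by
    unfold Function.uncurry
    exact ((continuous_fst.comp continuous_fst).sup (continuous_fst.comp continuous_snd)).prodMk
      ((continuous_snd.comp continuous_fst).sup (continuous_snd.comp continuous_snd))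
  exact map_mem_closure₂ hcont ha hb fun a ha b hb => supClosed_supDiff _ ha hb

/-- The first projection is bounded below on the complete space `G`, so its range is closed; it is
also a sublattice containing the coordinates, hence dense. -/
theorem exists_mem_topologicalClosure_krivineGraph [CompleteSpace X] {n : ℕ} (x : Fin n → X)
    (f : C(l1Sphere n, ℝ)) : ∃ z, (f, z) ∈ (krivineGraph x).topologicalClosure := by
  set G := (krivineGraph x).topologicalClosure
  let φ : G →ₗ[ℝ] C(l1Sphere n, ℝ) := (LinearMap.fst ℝ _ _).comp G.subtype
  have hφ : AntilipschitzWith (‖∑ j, |x j|‖₊ + 1) φ := by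
    refine AddMonoidHomClass.antilipschitz_of_bound φ fun w => ?_
    have h := norm_snd_le_of_mem_topologicalClosure x w.2
    change ‖w.1‖ ≤ (‖∑ j, |x j|‖ + 1) * ‖w.1.1‖
    rw [Prod.norm_def]
    refine max_le ?_ ?_ <;> nlinarith [norm_nonneg w.1.1, norm_nonneg (∑ j, |x j|)]
  have : CompleteSpace G := (krivineGraph x).isClosed_topologicalClosure.completeSpace_coe
  have hclosed : IsClosed (LinearMap.range φ : Set C(l1Sphere n, ℝ)) := by
    rw [LinearMap.coe_range]
    refine hφ.isClosed_range ?_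
    exact uniformContinuous_fst.comp uniformContinuous_subtype_val
  have hdense : Dense (LinearMap.range φ : Set C(l1Sphere n, ℝ)) := by
    refine dense_of_sphereCoord_mem _ ?_ fun j =>
      ⟨⟨_, subset_closure (coord_mem_krivineGraph x j)⟩, rfl⟩
    rintro _ ⟨a, rfl⟩ _ ⟨b, rfl⟩
    exact ⟨⟨a.1 ⊔ b.1, supClosed_topologicalClosure_krivineGraph x a.2 b.2⟩, rfl⟩
  have huniv := hclosed.closure_eq ▸ hdense.closure_eq
  obtain ⟨w, rfl⟩ : f ∈ (LinearMap.range φ : Set C(l1Sphere n, ℝ)) := huniv ▸ Set.mem_univ f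
  exact ⟨w.1.2, w.2⟩

theorem eq_of_mem_topologicalClosure_krivineGraph {n : ℕ} (x : Fin n → X)
    {f : C(l1Sphere n, ℝ)} {y z : X} (hy : (f, y) ∈ (krivineGraph x).topologicalClosure)
    (hz : (f, z) ∈ (krivineGraph x).topologicalClosure) : y = z := by
  have h := norm_snd_le_of_mem_topologicalClosure x (sub_mem hy hz)
  simpa [sub_eq_zero] using h

/-- The restriction of a homogeneous function to the sphere. -/
def HomogFun.restrict (n : ℕ) : HomogFun n →ₗ[ℝ] C(l1Sphere n, ℝ) where
  toFun h := h.1.restrict (l1Sphere n)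
  map_add' _ _ := rfl
  map_smul' _ _ := rfl

theorem exists_isKrivineCalculus [CompleteSpace X] {n : ℕ} (x : Fin n → X) :
    ∃ τ : HomogFun n →ₗ[ℝ] X, IsKrivineCalculus x τ := by
  choose F hF using exists_mem_topologicalClosure_krivineGraph x
  have huniq : ∀ {f z}, (f, z) ∈ (krivineGraph x).topologicalClosure → F f = z :=
    fun h => eq_of_mem_topologicalClosure_krivineGraph x (hF _) h
  let σ : C(l1Sphere n, ℝ) →ₗ[ℝ] X :=
    { toFun := F
      map_add' := fun f g => huniq (add_mem (hF f) (hF g))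
      map_smul' := fun c f => huniq (Submodule.smul_mem _ c (hF f)) }
  refine ⟨σ.comp (HomogFun.restrict n), fun j => ?_, fun f g => ?_⟩
  · exact huniq (subset_closure (coord_mem_krivineGraph x j))
  · exact huniq (supClosed_topologicalClosure_krivineGraph x (hF (HomogFun.restrict n f))
      (hF (HomogFun.restrict n g)))

end Existence

/-! ### Homogeneous functions and substitution -/

namespace HomogFun

theorem neg_apply {n : ℕ} (f : HomogFun n) (t : Fin n → ℝ) : (-f).1 t = -f.1 t := rfl

theorem smul_apply {n : ℕ} (c : ℝ) (f : HomogFun n) (t : Fin n → ℝ) :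
    (c • f).1 t = c * f.1 t := rfl

theorem sup_apply {n : ℕ} (f g : HomogFun n) (t : Fin n → ℝ) : (f ⊔ g).1 t = f.1 t ⊔ g.1 t := rfl

theorem proj_apply {n : ℕ} (j : Fin n) (t : Fin n → ℝ) : (proj j).1 t = t j := rfl

theorem sum_apply {n : ℕ} {ι : Type*} (s : Finset ι) (f : ι → HomogFun n) (t : Fin n → ℝ) :
    (∑ i ∈ s, f i).1 t = ∑ i ∈ s, (f i).1 t := by
  rw [AddSubmonoidClass.coe_finsetSum, ContinuousMap.sum_apply]

@[ext]
theorem ext {n : ℕ} {f g : HomogFun n} (h : ∀ t, f.1 t = g.1 t) : f = g :=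
  Subtype.ext (ContinuousMap.ext h)

/-- The function `t ↦ ∑ cⱼ |tⱼ|`. -/
def weightedL1 {n : ℕ} (c : Fin n → ℝ) : HomogFun n :=
  ∑ j, c j • (proj j ⊔ -proj j)

theorem weightedL1_apply {n : ℕ} (c : Fin n → ℝ) (t : Fin n → ℝ) :
    (weightedL1 c).1 t = ∑ j, c j * |t j| := by
  simp only [weightedL1, sum_apply, smul_apply, sup_apply, neg_apply, proj_apply]
  rfl

theorem le_mul_weightedL1 {n : ℕ} {f : HomogFun n} {c : ℝ} (h : ∀ t : l1Sphere n, f.1 t ≤ c)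
    (t : Fin n → ℝ) : f.1 t ≤ c * (weightedL1 1).1 t := by
  have hN : (weightedL1 (1 : Fin n → ℝ)).1 t = ∑ j, |t j| := by simp [weightedL1_apply]
  rw [hN]
  rcases (Finset.sum_nonneg fun j (_ : j ∈ Finset.univ) => abs_nonneg (t j)).eq_or_lt with h0 | h0
  · have ht : t = 0 := funext fun j => by
      simpa using (Finset.sum_eq_zero_iff_of_nonneg fun _ _ => abs_nonneg _).1 h0.symm j
        (Finset.mem_univ j)
    have hf := f.2 0 le_rfl 0
    rw [zero_smul, zero_mul] at hf
    rw [← h0, mul_zero, ht, hf]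
  · set N := ∑ j, |t j|
    have hs : N⁻¹ • t ∈ l1Sphere n := by
      change ∑ j, |N⁻¹ * t j| = 1
      simp_rw [abs_mul, ← Finset.mul_sum, abs_of_pos (inv_pos.2 h0)]
      exact inv_mul_cancel₀ h0.ne'
    have hle : f.1 (N⁻¹ • t) ≤ c := h ⟨_, hs⟩
    have hf := f.2 N h0.le (N⁻¹ • t)
    rw [smul_inv_smul₀ h0.ne'] at hf
    rw [hf, mul_comm c]
    exact mul_le_mul_of_nonneg_left hle h0.le

/-- The homogeneous function `t ↦ h (φ₁ t, …, φₙ t)`, as a linear function of `h`. -/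
def pullback {m n : ℕ} (φ : Fin n → HomogFun m) : HomogFun n →ₗ[ℝ] HomogFun m where
  toFun h := ⟨h.1.comp (ContinuousMap.pi fun j => (φ j).1), fun c hc t => by
    have : (fun j => (φ j).1 (c • t)) = c • fun j => (φ j).1 t :=
      funext fun j => (φ j).2 c hc t
    change h.1 (fun j => (φ j).1 (c • t)) = c * h.1 fun j => (φ j).1 t
    rw [this]
    exact h.2 c hc _⟩
  map_add' _ _ := rfl
  map_smul' _ _ := rfl

end HomogFun

/-! ### Uniqueness of the calculus and its consequences -/

section Calculus

variable {X : Type*} [NormedAddCommGroup X] [NormedSpace ℝ X] [Lattice X]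

theorem IsKrivineCalculus.mono {n : ℕ} {x : Fin n → X} {τ : HomogFun n →ₗ[ℝ] X}
    (hτ : IsKrivineCalculus x τ) {f g : HomogFun n} (h : ∀ t, f.1 t ≤ g.1 t) : τ f ≤ τ g := by
  have hfg : f ⊔ g = g := HomogFun.ext fun t => sup_eq_right.2 (h t)
  rw [← hfg, hτ.map_sup]
  exact le_sup_left

theorem IsKrivineCalculus.map_weightedL1 {n : ℕ} {x : Fin n → X} {τ : HomogFun n →ₗ[ℝ] X}
    (hτ : IsKrivineCalculus x τ) (c : Fin n → ℝ) :
    τ (HomogFun.weightedL1 c) = ∑ j, c j • |x j| := by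
  simp only [HomogFun.weightedL1, map_sum, map_smul, hτ.map_sup, map_neg, hτ.map_proj]
  rfl

theorem IsKrivineCalculus.pullback {m n : ℕ} {z : Fin m → X} {τ : HomogFun m →ₗ[ℝ] X}
    (hτ : IsKrivineCalculus z τ) (φ : Fin n → HomogFun m) :
    IsKrivineCalculus (fun j => τ (φ j)) (τ.comp (HomogFun.pullback φ)) where
  map_proj _ := rfl
  map_sup f g := hτ.map_sup (HomogFun.pullback φ f) (HomogFun.pullback φ g)

variable [HasSolidNorm X]

theorem IsKrivineCalculus.norm_le {n : ℕ} {x : Fin n → X} {τ : HomogFun n →ₗ[ℝ] X}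
    (hτ : IsKrivineCalculus x τ) (f : HomogFun n) :
    ‖τ f‖ ≤ ‖HomogFun.restrict n f‖ * ‖∑ j, |x j|‖ := by
  have key : ∀ g : HomogFun n,
      τ g ≤ ‖HomogFun.restrict n g‖ • ∑ j, |x j| := by
    intro g
    have h : ∑ j, |x j| = τ (HomogFun.weightedL1 1) := by simp [hτ.map_weightedL1]
    rw [h, ← map_smul]
    refine hτ.mono (HomogFun.le_mul_weightedL1 fun t => ?_)
    exact (le_abs_self _).trans ((HomogFun.restrict n g).norm_coe_le_norm t)
  have h2 := key (-f)
  rw [map_neg, map_neg, norm_neg] at h2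
  calc ‖τ f‖ ≤ ‖‖HomogFun.restrict n f‖ • ∑ j, |x j|‖ :=
        norm_le_norm_of_abs_le_abs ((abs_le'.2 ⟨key f, h2⟩).trans (le_abs_self _))
    _ = _ := by rw [norm_smul, norm_norm]

/-- The functions on which `τ` and `σ` agree form a sublattice containing the coordinates, dense on
the sphere; both maps are bounded for the supremum norm there. -/
theorem IsKrivineCalculus.unique {n : ℕ} {x : Fin n → X} {τ σ : HomogFun n →ₗ[ℝ] X}
    (hτ : IsKrivineCalculus x τ) (hσ : IsKrivineCalculus x σ) : τ = σ := by
  have hdense : Dense (((LinearMap.eqLocus τ σ).map (HomogFun.restrict n) : Submodule ℝ _) :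
      Set C(l1Sphere n, ℝ)) := by
    refine dense_of_sphereCoord_mem _ ?_ fun j =>
      ⟨HomogFun.proj j, (hτ.map_proj j).trans (hσ.map_proj j).symm, rfl⟩
    rintro _ ⟨f, hf, rfl⟩ _ ⟨g, hg, rfl⟩
    refine ⟨f ⊔ g, ?_, rfl⟩
    change τ (f ⊔ g) = σ (f ⊔ g)
    rw [hτ.map_sup, hσ.map_sup, show τ f = σ f from hf, show τ g = σ g from hg]
  ext h
  rw [← sub_eq_zero, ← norm_le_zero_iff]
  refine le_of_forall_pos_le_add fun ε hε => ?_
  set u := ‖∑ j, |x j|‖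
  have hu : 0 ≤ u := norm_nonneg _
  have hδ : 0 < ε / (2 * u + 1) := by positivity
  obtain ⟨_, ⟨f, hf, rfl⟩, hd⟩ := Metric.mem_closure_iff.1 (hdense (HomogFun.restrict n h)) _ hδ
  rw [dist_eq_norm, ← map_sub] at hd
  have h1 := hτ.norm_le (h - f)
  have h2 := hσ.norm_le (h - f)
  have heq : τ h - σ h = τ (h - f) - σ (h - f) := by
    rw [map_sub, map_sub, show τ f = σ f from hf]
    abel
  rw [heq, zero_add]
  calc ‖τ (h - f) - σ (h - f)‖ ≤ ‖τ (h - f)‖ + ‖σ (h - f)‖ := norm_sub_le _ _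
    _ ≤ ‖HomogFun.restrict n (h - f)‖ * (2 * u) := by linarith
    _ ≤ ε / (2 * u + 1) * (2 * u + 1) := by gcongr; linarith
    _ = ε := by field_simp

variable [CompleteSpace X] [IsOrderedAddMonoid X] [IsOrderedModule ℝ X]

theorem isKrivineCalculus_krivine {n : ℕ} (x : Fin n → X) : IsKrivineCalculus x (krivine x) := by
  have h := exists_isKrivineCalculus x
  rw [krivine, dif_pos h]
  exact h.choose_spec

/-- Both sides are calculi at the tuple of the `krivine z (φ j)`. -/
theorem krivine_pullback {m n : ℕ} (z : Fin m → X) (φ : Fin n → HomogFun m) (h : HomogFun n) :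
    krivine (fun j => krivine z (φ j)) h = krivine z (HomogFun.pullback φ h) :=
  LinearMap.congr_fun ((isKrivineCalculus_krivine _).unique
    ((isKrivineCalculus_krivine z).pullback φ)) h

end Calculus

/-! ### The norms on finite sequences and on tuples -/

namespace BanachSequenceLattice

variable (Y : BanachSequenceLattice)

theorem finNorm_nonneg (n : ℕ) (t : Fin n → ℝ) : 0 ≤ Y.finNorm n t := by
  let _ : Norm Y.carrier := ⟨Y.norm⟩
  obtain ⟨core, _⟩ := Y.isBanachNorm
  exact core.norm_nonneg _

theorem finNorm_mono {n : ℕ} {s t : Fin n → ℝ} (h : ∀ j, |s j| ≤ |t j|) :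
    Y.finNorm n s ≤ Y.finNorm n t := by
  refine Y.norm_mono _ _ fun k => ?_
  change |extendByZero n s k| ≤ |extendByZero n t k|
  by_cases hk : k < n
  · simpa [extendByZero, hk] using h ⟨k, hk⟩
  · simp [extendByZero, hk]

theorem finNorm_one_pos : 0 < Y.finNorm 1 1 := by
  let _ : Norm Y.carrier := ⟨Y.norm⟩
  obtain ⟨core, _⟩ := Y.isBanachNorm
  refine (Y.finNorm_nonneg 1 1).lt_of_ne' fun h => ?_
  have h0 := congrArg Subtype.val ((core.norm_eq_zero_iff _).1 h)
  have h1 : extendByZero 1 1 0 = 0 := congrFun h0 0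
  simp [extendByZero] at h1

theorem finNorm_fin_one (t : Fin 1 → ℝ) : Y.finNorm 1 t = Y.finNorm 1 1 * |t 0| := by
  have h : t = t 0 • (1 : Fin 1 → ℝ) := by
    ext j
    simp [Subsingleton.elim j 0]
  conv_lhs => rw [h]
  rw [Y.finNorm_smul, mul_comm]

theorem finNorm_le_sum {n : ℕ} (t : Fin n → ℝ) :
    Y.finNorm n t ≤ ∑ j, Y.finNorm n (Pi.single j 1) * |t j| := by
  have h0 : Y.finNorm n 0 = 0 := by simpa using Y.finNorm_smul n 0 0
  conv_lhs => rw [pi_eq_sum_univ' t]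
  refine (Finset.le_sum_of_subadditive (Y.finNorm n) h0.le (Y.finNorm_add_le n) _ _).trans
    (Finset.sum_le_sum fun j _ => ?_)
  rw [Y.finNorm_smul, mul_comm]

end BanachSequenceLattice

section TupleNorm

variable {E : Type*} [NormedAddCommGroup E] [NormedSpace ℝ E]

/-- `tupleNorm` as a seminorm on `Eⁿ`. -/
def tupleSeminorm (E : Type*) [NormedAddCommGroup E] [NormedSpace ℝ E]
    (Y : BanachSequenceLattice) (n : ℕ) : Seminorm ℝ (Fin n → E) :=
  Seminorm.of (tupleNorm Y)
    (fun v w => by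
      refine le_trans (Y.finNorm_mono fun j => ?_) (Y.finNorm_add_le n _ _)
      rw [abs_norm]
      exact (norm_add_le _ _).trans (le_abs_self _))
    (fun c w => by
      have h : (fun j => ‖(c • w) j‖) = |c| • fun j => ‖w j‖ := funext fun j => norm_smul c (w j)
      rw [tupleNorm, tupleNorm, h, Y.finNorm_smul, abs_abs, Real.norm_eq_abs])

theorem continuous_tupleSeminorm (Y : BanachSequenceLattice) (n : ℕ) :
    Continuous (tupleSeminorm E Y n) :=
  (Y.continuous_finNorm n).comp (by fun_prop)

omit [NormedSpace ℝ E] in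
theorem tupleNorm_fin_one (Y : BanachSequenceLattice) (w : Fin 1 → E) :
    tupleNorm Y w = Y.finNorm 1 1 * ‖w 0‖ := by
  rw [tupleNorm, Y.finNorm_fin_one, abs_norm]

end TupleNorm

/-! ### The lattice norm is a continuous seminorm -/

section LatticeNorm

variable {X : Type*} [NormedAddCommGroup X] [NormedSpace ℝ X] [CompleteSpace X]
  [Lattice X] [IsOrderedAddMonoid X] [IsOrderedModule ℝ X] [HasSolidNorm X]
  (Y : BanachSequenceLattice)

theorem norm_le_norm_of_nonneg_of_le {X : Type*} [NormedAddCommGroup X] [Lattice X]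
    [IsOrderedAddMonoid X] [HasSolidNorm X] {a b : X} (ha : 0 ≤ a) (hab : a ≤ b) : ‖a‖ ≤ ‖b‖ :=
  norm_le_norm_of_abs_le_abs (by rwa [abs_of_nonneg ha, abs_of_nonneg (ha.trans hab)])

theorem norm_krivine_mono {n : ℕ} (x : Fin n → X) {f g : HomogFun n} (hf : ∀ t, 0 ≤ f.1 t)
    (hfg : ∀ t, f.1 t ≤ g.1 t) : ‖krivine x f‖ ≤ ‖krivine x g‖ := by
  have hx := isKrivineCalculus_krivine x
  refine norm_le_norm_of_nonneg_of_le ?_ (hx.mono hfg)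
  rw [← map_zero (krivine x)]
  exact hx.mono hf

theorem latticeNorm_krivine {m n : ℕ} (z : Fin m → X) (φ : Fin n → HomogFun m) :
    latticeNorm Y (fun j => krivine z (φ j)) =
      ‖krivine z (HomogFun.pullback φ (HomogFun.ofNorm Y n))‖ := by
  rw [latticeNorm, krivine_pullback]

theorem latticeNorm_add_le {n : ℕ} (x y : Fin n → X) :
    latticeNorm Y (x + y) ≤ latticeNorm Y x + latticeNorm Y y := by
  -- Over the concatenated tuple, `x`, `y` and `x + y` all come from one calculus, and the claim
  -- reduces to the triangle inequality of `Y.finNorm` at points of `ℝ²ⁿ`.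
  set z : Fin (n + n) → X := Fin.append x y
  have hz := isKrivineCalculus_krivine z
  set φ : Fin n → HomogFun (n + n) := fun j => HomogFun.proj (Fin.castAdd n j)
  set ψ : Fin n → HomogFun (n + n) := fun j => HomogFun.proj (Fin.natAdd n j)
  have hx : x = fun j => krivine z (φ j) := funext fun j => by
    exact (Fin.append_left x y j).symm.trans (hz.map_proj _).symm
  have hy : y = fun j => krivine z (ψ j) := funext fun j => by
    exact (Fin.append_right x y j).symm.trans (hz.map_proj _).symm
  have hxy : x + y = fun j => krivine z (φ j + ψ j) := funext fun j => by
    rw [map_add, Pi.add_apply]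
    exact congrArg₂ _ (congrFun hx j) (congrFun hy j)
  rw [hxy, latticeNorm_krivine]
  conv_rhs => rw [hx, hy, latticeNorm_krivine, latticeNorm_krivine]
  refine le_trans (norm_krivine_mono z (fun t => Y.finNorm_nonneg n _) fun t => ?_)
    ((congrArg norm (map_add _ _ _)).trans_le (norm_add_le _ _))
  exact Y.finNorm_add_le n _ _

theorem latticeNorm_smul {n : ℕ} (c : ℝ) (x : Fin n → X) :
    latticeNorm Y (c • x) = ‖c‖ * latticeNorm Y x := by
  have hx := isKrivineCalculus_krivine x
  have h : c • x = fun j => krivine x (c • HomogFun.proj j) := funext fun j => by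
    rw [map_smul, hx.map_proj, Pi.smul_apply]
  rw [h, latticeNorm_krivine, latticeNorm, ← norm_abs_eq_norm c, ← norm_smul, ← map_smul]
  congr 2
  exact HomogFun.ext fun t => Y.finNorm_smul n c t

/-- Applies the calculus to `‖t‖_Y ≤ ∑ ‖eⱼ‖_Y |tⱼ|`; this yields continuity of the seminorm at `0`.
-/
theorem latticeNorm_le_sum {n : ℕ} (x : Fin n → X) :
    latticeNorm Y x ≤ ∑ j, Y.finNorm n (Pi.single j 1) * ‖x j‖ := by
  have h : latticeNorm Y x ≤
      ‖krivine x (HomogFun.weightedL1 fun j => Y.finNorm n (Pi.single j 1))‖ :=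
    norm_krivine_mono x (fun t => Y.finNorm_nonneg n t) fun t => by
      rw [HomogFun.weightedL1_apply]
      exact Y.finNorm_le_sum t
  refine h.trans ?_
  rw [(isKrivineCalculus_krivine x).map_weightedL1]
  refine (norm_sum_le _ _).trans_eq (Finset.sum_congr rfl fun j _ => ?_)
  rw [norm_smul, norm_abs_eq_norm, Real.norm_of_nonneg (Y.finNorm_nonneg n _)]

theorem latticeNorm_fin_one (x : Fin 1 → X) : latticeNorm Y x = Y.finNorm 1 1 * ‖x 0‖ := by
  have h : HomogFun.ofNorm Y 1 = HomogFun.weightedL1 fun _ => Y.finNorm 1 1 :=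
    HomogFun.ext fun t => by
      rw [HomogFun.weightedL1_apply, Fin.sum_univ_one]
      exact Y.finNorm_fin_one t
  rw [latticeNorm, h, (isKrivineCalculus_krivine x).map_weightedL1, Fin.sum_univ_one, norm_smul,
    norm_abs_eq_norm, Real.norm_of_nonneg (Y.finNorm_nonneg 1 1)]

variable (X) in
/-- `latticeNorm` as a seminorm on `Xⁿ`. -/
noncomputable def latticeSeminorm (n : ℕ) : Seminorm ℝ (Fin n → X) :=
  Seminorm.of (latticeNorm Y) (latticeNorm_add_le Y) (latticeNorm_smul Y)

theorem continuous_latticeSeminorm (n : ℕ) : Continuous (latticeSeminorm X Y n) := by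
  refine Seminorm.continuous_of_continuousAt_zero ?_
  rw [ContinuousAt, map_zero]
  refine squeeze_zero (fun x => apply_nonneg _ x) (latticeNorm_le_sum Y) ?_
  have hcont : Continuous fun x : Fin n → X => ∑ j, Y.finNorm n (Pi.single j 1) * ‖x j‖ := by
    fun_prop
  simpa using hcont.tendsto 0

end LatticeNorm

/-! ### Banach spaces of operators defined by tuple inequalities -/

theorem isBanachNorm_of_complete {V : Type*} [AddCommGroup V] [Module ℝ V] {N : V → ℝ}
    (nonneg : ∀ v, 0 ≤ N v) (smul : ∀ (c : ℝ) v, N (c • v) = |c| * N v)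
    (triangle : ∀ v w, N (v + w) ≤ N v + N w) (eq_zero : ∀ v, N v = 0 → v = 0)
    (complete : ∀ u : ℕ → V, (∀ ε > 0, ∃ k₀, ∀ k ≥ k₀, ∀ l ≥ k₀, N (u k - u l) < ε) →
      ∃ v, ∀ ε > 0, ∃ k₀, ∀ k ≥ k₀, N (u k - v) ≤ ε) : IsBanachNorm N := by
  let _ : Norm V := ⟨N⟩
  have core : NormedSpace.Core ℝ V :=
    { norm_nonneg := nonneg
      norm_smul := smul
      norm_triangle := triangle
      norm_eq_zero_iff := fun v => ⟨eq_zero v, fun h => by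
        have h0 : N 0 = 0 := by simpa using smul 0 0
        rw [h]
        exact h0⟩ }
  refine ⟨core, ?_⟩
  let _ : NormedAddCommGroup V := NormedAddCommGroup.ofCore core
  refine Metric.complete_of_cauchySeq_tendsto fun u hu => ?_
  obtain ⟨v, hv⟩ := complete u fun ε hε => by
    obtain ⟨k₀, hk₀⟩ := Metric.cauchySeq_iff.1 hu ε hε
    refine ⟨k₀, fun k hk l hl => ?_⟩
    have h := hk₀ k hk l hl
    rw [dist_eq_norm] at h
    exact h
  refine ⟨v, Metric.tendsto_atTop.2 fun ε hε => ?_⟩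
  obtain ⟨k₀, hk₀⟩ := hv (ε / 2) (half_pos hε)
  refine ⟨k₀, fun k hk => ?_⟩
  rw [dist_eq_norm]
  exact (hk₀ k hk).trans_lt (half_lt_self hε)

section TupleBound

variable {A B : Type*} [NormedAddCommGroup A] [NormedSpace ℝ A] [NormedAddCommGroup B]
  [NormedSpace ℝ B]

/-- `C` is a bound for `T` with respect to gauges `p`, `q` of the finite families in `B` and `A`. -/
def TupleBound (p : ∀ n : ℕ, Seminorm ℝ (Fin n → B)) (q : ∀ n : ℕ, (Fin n → A) → ℝ)
    (T : A →ₗ[ℝ] B) (C : ℝ) : Prop :=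
  ∀ (n : ℕ) (w : Fin n → A), p n (fun j => T (w j)) ≤ C * q n w

/-- The smallest bound for `T`. -/
noncomputable def tupleConst (p : ∀ n : ℕ, Seminorm ℝ (Fin n → B))
    (q : ∀ n : ℕ, (Fin n → A) → ℝ) (T : A →ₗ[ℝ] B) : ℝ :=
  sInf {C : ℝ | 0 ≤ C ∧ TupleBound p q T C}

variable {p : ∀ n : ℕ, Seminorm ℝ (Fin n → B)} {q : ∀ n : ℕ, (Fin n → A) → ℝ}

theorem TupleBound.mono (hq : ∀ n w, 0 ≤ q n w) {T : A →ₗ[ℝ] B} {C D : ℝ}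
    (h : TupleBound p q T C) (hCD : C ≤ D) : TupleBound p q T D := fun n w =>
  (h n w).trans (mul_le_mul_of_nonneg_right hCD (hq n w))

theorem TupleBound.add {S T : A →ₗ[ℝ] B} {C D : ℝ} (hS : TupleBound p q S C)
    (hT : TupleBound p q T D) : TupleBound p q (S + T) (C + D) := fun n w => by
  rw [add_mul]
  exact (map_add_le_add (p n) (fun j => S (w j)) (fun j => T (w j))).trans
    (add_le_add (hS n w) (hT n w))

theorem TupleBound.smul {T : A →ₗ[ℝ] B} {C : ℝ} (c : ℝ) (hT : TupleBound p q T C) :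
    TupleBound p q (c • T) (|c| * C) := fun n w => by
  rw [mul_assoc]
  exact (map_smul_eq_mul (p n) c fun j => T (w j)).trans_le
    (mul_le_mul_of_nonneg_left (hT n w) (abs_nonneg c))

theorem tupleBound_zero : TupleBound p q 0 0 := fun n w => by
  rw [zero_mul]
  exact (map_zero (p n)).le

/-- Each tuple imposes a closed condition on `C`, so the infimum is attained. -/
theorem isLeast_tupleConst {T : A →ₗ[ℝ] B} (h : ∃ C, 0 < C ∧ TupleBound p q T C) :
    IsLeast {C : ℝ | 0 ≤ C ∧ TupleBound p q T C} (tupleConst p q T) := by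
  have hbdd : BddBelow {C : ℝ | 0 ≤ C ∧ TupleBound p q T C} := ⟨0, fun C hC => hC.1⟩
  refine ⟨IsClosed.csInf_mem ?_ ?_ hbdd, fun C hC => csInf_le hbdd hC⟩
  · have hset : {C : ℝ | 0 ≤ C ∧ TupleBound p q T C} =
        Set.Ici 0 ∩ ⋂ n, ⋂ w, {C | p n (fun j => T (w j)) ≤ C * q n w} := by
      ext C
      simp [TupleBound]
    rw [hset]
    refine isClosed_Ici.inter ?_
    exact isClosed_iInter fun n => isClosed_iInter fun w => isClosed_le (by fun_prop) (by fun_prop)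
  · obtain ⟨C, hC, hT⟩ := h
    exact ⟨C, hC.le, hT⟩

/-- The common factor `c` cancels, so `e₁` need not have norm one in `Y`. -/
theorem TupleBound.norm_le {c : ℝ} (hc : 0 < c) (hp1 : ∀ w, p 1 w = c * ‖w 0‖)
    (hq1 : ∀ w, q 1 w = c * ‖w 0‖) {T : A →ₗ[ℝ] B} {C : ℝ} (h : TupleBound p q T C) (w : A) :
    ‖T w‖ ≤ C * ‖w‖ := by
  have h1 := h 1 fun _ => w
  rw [hp1, hq1, mul_left_comm] at h1
  exact le_of_mul_le_mul_left h1 hc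

theorem TupleBound.of_tendsto (hp : ∀ n, Continuous (p n)) {T : ℕ → A →ₗ[ℝ] B} {S : A →ₗ[ℝ] B}
    {C : ℝ} (hT : ∀ᶠ k in Filter.atTop, TupleBound p q (T k) C)
    (hTS : ∀ w, Filter.Tendsto (fun k => T k w) Filter.atTop (nhds (S w))) :
    TupleBound p q S C := fun n w =>
  le_of_tendsto (((hp n).tendsto _).comp (tendsto_pi_nhds.2 fun j => hTS (w j)))
    (hT.mono fun _ hk => hk n w)

variable (p q) in
/-- The space of the operators which have a bound. -/
def tupleBounded (hq : ∀ n w, 0 ≤ q n w) : Submodule ℝ (A →ₗ[ℝ] B) where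
  carrier := {T | ∃ C, 0 < C ∧ TupleBound p q T C}
  zero_mem' := ⟨1, one_pos, tupleBound_zero.mono hq zero_le_one⟩
  add_mem' := by
    rintro S T ⟨C, hC, hS⟩ ⟨D, hD, hT⟩
    exact ⟨C + D, add_pos hC hD, hS.add hT⟩
  smul_mem' := by
    rintro c T ⟨C, hC, hT⟩
    -- The `+ 1` keeps the constant positive when `c = 0`.
    exact ⟨|c| * C + 1, by positivity, (hT.smul c).mono hq (by linarith)⟩

theorem exists_tendsto_of_cauchy [CompleteSpace B] (hp : ∀ n, Continuous (p n)) {c : ℝ}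
    (hc : 0 < c) (hp1 : ∀ w, p 1 w = c * ‖w 0‖) (hq1 : ∀ w, q 1 w = c * ‖w 0‖)
    (u : ℕ → A →ₗ[ℝ] B)
    (hu : ∀ ε > 0, ∃ k₀, ∀ k ≥ k₀, ∀ l ≥ k₀, TupleBound p q (u k - u l) ε) :
    ∃ S : A →ₗ[ℝ] B, ∀ ε > 0, ∃ k₀, ∀ k ≥ k₀, TupleBound p q (u k - S) ε := by
  have hcauchy : ∀ w, CauchySeq fun k => u k w := by
    intro w
    refine Metric.cauchySeq_iff.2 fun ε hε => ?_
    have hδ : 0 < ε / (‖w‖ + 1) := by positivity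
    obtain ⟨k₀, hk₀⟩ := hu _ hδ
    refine ⟨k₀, fun k hk l hl => ?_⟩
    rw [dist_eq_norm]
    calc ‖u k w - u l w‖ ≤ ε / (‖w‖ + 1) * ‖w‖ := (hk₀ k hk l hl).norm_le hc hp1 hq1 w
      _ < ε / (‖w‖ + 1) * (‖w‖ + 1) := by gcongr; linarith
      _ = ε := by field_simp
  choose F hF using fun w => cauchySeq_tendsto_of_complete (hcauchy w)
  let S : A →ₗ[ℝ] B :=
    { toFun := F
      map_add' := fun v w => tendsto_nhds_unique (hF (v + w)) (by
        simpa only [map_add] using (hF v).add (hF w))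
      map_smul' := fun r w => tendsto_nhds_unique (hF (r • w)) (by
        simpa only [map_smul, RingHom.id_apply] using (hF w).const_smul r) }
  refine ⟨S, fun ε hε => ?_⟩
  obtain ⟨k₀, hk₀⟩ := hu ε hε
  refine ⟨k₀, fun k hk => TupleBound.of_tendsto hp (T := fun l => u k - u l) ?_ fun w => ?_⟩
  · filter_upwards [Filter.eventually_ge_atTop k₀] with l hl using hk₀ k hk l hl
  · exact (hF w).const_sub (u k w)

theorem isBanachNorm_tupleConst [CompleteSpace B] (hp : ∀ n, Continuous (p n))
    (hq : ∀ n w, 0 ≤ q n w) {c : ℝ} (hc : 0 < c) (hp1 : ∀ w, p 1 w = c * ‖w 0‖)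
    (hq1 : ∀ w, q 1 w = c * ‖w 0‖) :
    IsBanachNorm fun T : tupleBounded p q hq => tupleConst p q (T : A →ₗ[ℝ] B) := by
  have hleast := fun T : tupleBounded p q hq => isLeast_tupleConst T.2
  have hsmul : ∀ (r : ℝ) (T : tupleBounded p q hq),
      tupleConst p q (r • T : A →ₗ[ℝ] B) ≤ |r| * tupleConst p q (T : A →ₗ[ℝ] B) := fun r T =>
    (hleast (r • T)).2 ⟨mul_nonneg (abs_nonneg r) (hleast T).1.1, (hleast T).1.2.smul r⟩
  refine isBanachNorm_of_complete (fun T => (hleast T).1.1) (fun r T => ?_) (fun S T => ?_)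
    (fun T hT => ?_) fun u hu => ?_
  · refine le_antisymm (hsmul r T) ?_
    rcases eq_or_ne r 0 with rfl | hr
    · rw [abs_zero, zero_mul]
      exact (hleast _).1.1
    -- The reverse inequality is `hsmul` for the inverse scalar.
    · have h := hsmul r⁻¹ (r • T)
      rw [Submodule.coe_smul, inv_smul_smul₀ hr, abs_inv] at h
      rwa [← le_inv_mul_iff₀ (abs_pos.2 hr)]
  · exact (hleast (S + T)).2
      ⟨add_nonneg (hleast S).1.1 (hleast T).1.1, (hleast S).1.2.add (hleast T).1.2⟩
  · ext w
    have h := (hleast T).1.2.norm_le hc hp1 hq1 w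
    rw [hT, zero_mul] at h
    exact norm_le_zero_iff.1 h
  · obtain ⟨S, hS⟩ := exists_tendsto_of_cauchy hp hc hp1 hq1 (fun k => (u k : A →ₗ[ℝ] B))
      fun ε hε => by
        obtain ⟨k₀, hk₀⟩ := hu ε hε
        exact ⟨k₀, fun k hk l hl => (hleast (u k - u l)).1.2.mono hq (hk₀ k hk l hl).le⟩
    have hmem : S ∈ tupleBounded p q hq := by
      obtain ⟨k₀, hk₀⟩ := hS 1 one_pos
      have h : (u k₀ : A →ₗ[ℝ] B) - S ∈ tupleBounded p q hq := ⟨1, one_pos, hk₀ k₀ le_rfl⟩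
      simpa using sub_mem (u k₀).2 h
    refine ⟨⟨S, hmem⟩, fun ε hε => ?_⟩
    obtain ⟨k₀, hk₀⟩ := hS ε hε
    refine ⟨k₀, fun k hk => ?_⟩
    have h : TupleBound p q ((u k - ⟨S, hmem⟩ : tupleBounded p q hq) : A →ₗ[ℝ] B) ε := hk₀ k hk
    exact (hleast _).2 ⟨hε.le, h⟩

theorem exists_submodule_tupleConst [CompleteSpace B] (hp : ∀ n, Continuous (p n))
    (hq : ∀ n w, 0 ≤ q n w) {c : ℝ} (hc : 0 < c) (hp1 : ∀ w, p 1 w = c * ‖w 0‖)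
    (hq1 : ∀ w, q 1 w = c * ‖w 0‖) :
    ∃ K : Submodule ℝ (A →ₗ[ℝ] B),
      (∀ T : A →ₗ[ℝ] B, T ∈ K ↔ ∃ C : ℝ, 0 < C ∧ TupleBound p q T C) ∧
      (∀ T ∈ K, IsLeast {C : ℝ | 0 ≤ C ∧ TupleBound p q T C} (tupleConst p q T)) ∧
      IsBanachNorm (fun T : K => tupleConst p q (T : A →ₗ[ℝ] B)) ∧
      ∀ T ∈ K, ∃ T' : A →L[ℝ] B, (T' : A →ₗ[ℝ] B) = T ∧ ‖T'‖ ≤ tupleConst p q T := by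
  refine ⟨tupleBounded p q hq, fun T => Iff.rfl, fun T hT => isLeast_tupleConst hT,
    isBanachNorm_tupleConst hp hq hc hp1 hq1, fun T hT => ?_⟩
  have hleast := isLeast_tupleConst hT
  have h := hleast.1.2.norm_le hc hp1 hq1
  exact ⟨T.mkContinuous _ h, rfl, T.mkContinuous_norm_le hleast.1.1 h⟩

end TupleBound

theorem mainTheorem3
    {E : Type*} [NormedAddCommGroup E] [NormedSpace ℝ E] [CompleteSpace E]
    {X : Type*} [NormedAddCommGroup X] [NormedSpace ℝ X] [CompleteSpace X]
    [Lattice X] [IsOrderedAddMonoid X] [IsOrderedModule ℝ X] [HasSolidNorm X]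
    (Y : BanachSequenceLattice) :
    (∃ K : Submodule ℝ (E →ₗ[ℝ] X),
      (∀ T : E →ₗ[ℝ] X, T ∈ K ↔ IsYConvex Y T) ∧
      (∀ T ∈ K, IsLeast {C : ℝ | 0 ≤ C ∧ YConvexBound Y T C} (yConvexityConst Y T)) ∧
      IsBanachNorm (fun T : K => yConvexityConst Y (T : E →ₗ[ℝ] X)) ∧
      ∀ T ∈ K, ∃ T' : E →L[ℝ] X, (T' : E →ₗ[ℝ] X) = T ∧ ‖T'‖ ≤ yConvexityConst Y T) ∧
    (∃ K : Submodule ℝ (X →ₗ[ℝ] E),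
      (∀ S : X →ₗ[ℝ] E, S ∈ K ↔ IsYConcave Y S) ∧
      (∀ S ∈ K, IsLeast {C : ℝ | 0 ≤ C ∧ YConcaveBound Y S C} (yConcavityConst Y S)) ∧
      IsBanachNorm (fun S : K => yConcavityConst Y (S : X →ₗ[ℝ] E)) ∧
      ∀ S ∈ K, ∃ S' : X →L[ℝ] E, (S' : X →ₗ[ℝ] E) = S ∧ ‖S'‖ ≤ yConcavityConst Y S) := by
  exact ⟨exists_submodule_tupleConst (p := latticeSeminorm X Y) (q := fun n w => tupleNorm Y w)
      (continuous_latticeSeminorm Y) (fun n _ => Y.finNorm_nonneg n _) Y.finNorm_one_pos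
      (latticeNorm_fin_one Y) (tupleNorm_fin_one Y),
    exists_submodule_tupleConst (p := tupleSeminorm E Y) (q := fun n x => latticeNorm Y x)
      (continuous_tupleSeminorm Y) (fun _ _ => norm_nonneg _) Y.finNorm_one_pos
      (tupleNorm_fin_one Y) (latticeNorm_fin_one Y)⟩
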